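/- **Theorem (Convergence Rate under Convexity).** There is an absolute constant $C>0$ such that the following holds. Let $U,n,\tau,T\ge 1$ be integers and let $\mathcal L_1,\dots,\mathcal L_U:\mathbb R^d\to\mathbb R$ be differentiable, $L$-smooth ($\|\nabla\mathcal L_u(w)-\nabla\mathcal L_u(w')\|\le L\|w-w'\|$, $L>0$) and $\mu$-strongly convex ($\langle\nabla\mathcal L_u(w)-\nabla\mathcal L_u(w'),w-w'\rangle\ge\mu\|w-w'\|^2$, $\mu>0$). Let $\mathcal L=\frac1U\sum_u\mathcal L_u$, let $\theta^*$ be a global minimizer of $\mathcal L$, and let $\frac1U\sum_u\|\nabla\mathcal L_u(\theta^*)\|^2\le\sigma_*^2$. Consider ADP-QFL with full client participation and full-batch $n$-qubit gradients: starting from $\theta^{(0)}\in\mathbb R^d$, for every round $t$ and client $u$ put $\theta_u^{(t,0)}=\theta^{(t)}$, $$\theta_u^{(t,k+1)}=\theta_u^{(t,k)}-\eta_l\,\hat g_u^{(t,k)}\quad(0\le k<\tau),\qquad \theta^{(t+1)}=\frac1U\sum_{u=1}^U\theta_u^{(t,\tau)}.$$ Here, with $\bar g=\nabla\mathcal L_u(\theta_u^{(t,k)})$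 and with $g_1,\dots,g_{N_u}$ the (random, square-integrable) point-wise gradients of all $N_u\ge1$ data points of client $u$ at that step, $$\hat g_u^{(t,k)}=\bar g+\sqrt{\tfrac{3}{2^{2n}-1}}\;\frac1{N_u}\sum_{i=1}^{N_u}(g_i-\bar g),$$ so that the $n$-qubit encoding multiplies the gradient variance by $3/(2^{2n}-1)$. Conditionally on the past (of all clients) the average $\frac1{N_u}\sum_i g_i$ has mean $\bar g$, and $\mathbb E\|g_i-\bar g\|^2\le\sigma^2$ for every $i$. Suppose that $\frac{1}{2\sqrt6\,\tau^2L}<\eta_l<\frac1{6\tau L}$. Then $\bar\theta=\frac1T\sum_{t=0}^{T-1}\theta^{(t)}$ has $\mathcal L(\bar\theta)$ integrable and $$\mathbb E[\mathcal L(\bar\theta)]-\mathcal L(\theta^*)\le C\,\frac{\|\theta^{(0)}-\theta^*\|^2}{\sum_{t=0}^{T-1}\eta_l\tau}+C\,\eta_l^2\tau(\tau-1)L\sigma_*^2+C\,\eta_l\tau\sigma_*^2+C\,L\,(2\tau^2+3\tau+1)\,\eta_l^2\cdot\frac{3\sigma^2}{2^{2n}-1}.$$ The four terms are the initialization error, the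 client drift, the noise at the optimum and the quantum-induced gradient variance. -/

import Mathlib

open MeasureTheory

noncomputable section

namespace ADPQFL

/-- The parameter space `ℝ^d` with its Euclidean norm. -/
abbrev Param (d : ℕ) : Type := EuclideanSpace ℝ (Fin d)

/-- `f` is differentiable and its gradient is `L`-Lipschitz. -/
structure IsLSmooth {d : ℕ} (L : ℝ) (f : Param d → ℝ) : Prop where
  differentiable : Differentiable ℝ f
  lipschitz : ∀ w w' : Param d, ‖gradient f w - gradient f w'‖ ≤ L * ‖w - w'‖

/-- `f` is differentiable and `m`-strongly convex, in the gradient form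
`(∇f(w) - ∇f(w'))ᵀ (w - w') ≥ m ‖w - w'‖²`. -/
structure IsMStronglyConvex {d : ℕ} (m : ℝ) (f : Param d → ℝ) : Prop where
  differentiable : Differentiable ℝ f
  strongly_monotone : ∀ w w' : Param d,
    inner ℝ (gradient f w - gradient f w') (w - w') ≥ m * ‖w - w'‖ ^ 2

/-- The global loss `𝓛(θ) = (1/U) ∑ᵤ 𝓛ᵤ(θ)`. -/
def globalLoss {d U : ℕ} (F : Fin U → Param d → ℝ) (θ : Param d) : ℝ :=
  (1 / (U : ℝ)) * ∑ u, F u θ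

/-- The full-batch `n`-qubit gradient built from the point-wise gradients
`gᵢ = ḡ + Δgᵢ`, `i = 1, …, N`, of all `N` data points of a client. The deviation
`(1/N) ∑ᵢ Δgᵢ` of the full batch from the exact gradient `ḡ` is damped so that its variance
is multiplied by `3 / (2^{2n} - 1)`; for `n = 1` this is the plain average of the `gᵢ`. -/
def nQubitGradient {d N : ℕ} (n : ℕ) (gbar : Param d) (g : Fin N → Param d) : Param d :=
  gbar + √(3 / ((2 : ℝ) ^ (2 * n) - 1)) • ((1 / (N : ℝ)) • ∑ i, (g i - gbar))

/-- The local model of one client after `k` local steps from the received global model `θ`: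
`θ^{(t,0)} = θ` and `θ^{(t,k+1)} = θ^{(t,k)} - η g^{(t,k)}`, where `g^{(t,k)}` is the `n`-qubit
gradient at `θ^{(t,k)}`. Here `f` is the client's objective and `g k i` is the point-wise
gradient of data point `i` at local step `k`. -/
def localModel {d N : ℕ} (n : ℕ) (η : ℝ) (f : Param d → ℝ) (g : ℕ → Fin N → Param d)
    (θ : Param d) : ℕ → Param d
  | 0 => θ
  | k + 1 => localModel n η f g θ k
      - η • nQubitGradient n (gradient f (localModel n η f g θ k)) (g k)

/-- The global model after `t` rounds: in each round all `U` clients run `τ` local steps from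
the current global model, and the server averages the resulting local models.
`g t k u i` is the point-wise gradient of data point `i` of client `u` at local step `k` of
round `t`. -/
def globalModel {d U : ℕ} {N : Fin U → ℕ} (n τ : ℕ) (η : ℝ) (F : Fin U → Param d → ℝ)
    (g : ℕ → ℕ → (u : Fin U) → Fin (N u) → Param d) (θ₀ : Param d) : ℕ → Param d
  | 0 => θ₀
  | t + 1 => (1 / (U : ℝ)) • ∑ u,
      localModel n η (F u) (fun k => g t k u) (globalModel n τ η F g θ₀ t) τ

/-- The local model `θᵤ^{(t,k)}` of client `u` in round `t` after `k` local steps. -/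
def clientModel {d U : ℕ} {N : Fin U → ℕ} (n τ : ℕ) (η : ℝ) (F : Fin U → Param d → ℝ)
    (g : ℕ → ℕ → (u : Fin U) → Fin (N u) → Param d) (θ₀ : Param d)
    (t k : ℕ) (u : Fin U) : Param d :=
  localModel n η (F u) (fun k => g t k u) (globalModel n τ η F g θ₀ t) k

/-- The averaged iterate `θ̄ = (1/T) ∑_{t < T} θ^{(t)}`. -/
def averagedModel {d U : ℕ} {N : Fin U → ℕ} (n τ : ℕ) (η : ℝ) (F : Fin U → Param d → ℝ)
    (g : ℕ → ℕ → (u : Fin U) → Fin (N u) → Param d) (θ₀ : Param d) (T : ℕ) : Param d :=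
  (1 / (T : ℝ)) • ∑ t ∈ Finset.range T, globalModel n τ η F g θ₀ t

/-- The point-wise gradients `g t k u i : Ω → ℝ^d` used along a run are stochastic gradients
with variance at most `σ²`: `𝓕 s` is the information available before the `s`-th local step
overall (local step `k` of round `t` is the step `s = t τ + k`); given it, the average of the
point-wise gradients over all data points of client `u` is an unbiased estimate of the exact
gradient `ḡ = ∇Fᵤ(θᵤ^{(t,k)})`, and each point-wise gradient satisfies `E‖gᵢ - ḡ‖² ≤ σ²`. -/
structure IsStochasticGradient {d U : ℕ} {N : Fin U → ℕ} {Ω : Type*} {mΩ : MeasurableSpace Ω}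
    (P : Measure Ω) (𝓕 : Filtration ℕ mΩ) (n τ : ℕ) (η : ℝ) (F : Fin U → Param d → ℝ)
    (g : ℕ → ℕ → (u : Fin U) → Fin (N u) → Ω → Param d) (θ₀ : Param d) (σ : ℝ) : Prop where
  adapted : ∀ t k, k < τ → ∀ u i, StronglyMeasurable[𝓕 (t * τ + k + 1)] (g t k u i)
  memLp : ∀ t k, k < τ → ∀ u i, MemLp (g t k u i) 2 P
  unbiased : ∀ t k, k < τ → ∀ u,
    P[(fun ω => (1 / (N u : ℝ)) • ∑ i, g t k u i ω) | 𝓕 (t * τ + k)] =ᵐ[P]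
      fun ω => gradient (F u)
        (clientModel n τ η F (fun t k u i => g t k u i ω) θ₀ t k u)
  variance_le : ∀ t k, k < τ → ∀ u i,
    ∫ ω, ‖g t k u i ω - gradient (F u)
        (clientModel n τ η F (fun t k u i => g t k u i ω) θ₀ t k u)‖ ^ 2 ∂P ≤ σ ^ 2

end ADPQFL

end

/-! Each local step is a gradient step with an additive error, the gradient noise. Since the joint
past of all clients makes this noise conditionally centred, the proof splits into a deterministic
inequality for one round and an averaging over the noise.

Write `δ` for the optimality gap at the start of a round, `S` for the client-averaged sum of squared
distances of the local iterates from that start, and `Ξ` for the summed average noise of the round.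
Expanding the squared distance to the minimizer after a round leaves three estimates. Convexity and
smoothness bound the inner product below by `τδ - LS/2` (`IsLSmooth.inner_sum_gradient_ge`).
Co-coercivity, together with the vanishing mean gradient at the minimizer, bounds the averaged
gradient by `S` and `δ` (`norm_average_sum_gradient_sq_le`). Finally `ητL ≤ 1/6` makes the drift
recursion a contraction, so `S` is controlled by `δ`, the gradients at the optimum and the noise
(`IsNoisyDescent.sum_norm_sub_sq_le`). Together they give a decrease of `ητδ/4` up to noise
(`norm_average_noisyDescent_sub_sq_le`).

In expectation the term linear in `Ξ` vanishes, and `E‖Ξ‖²` is the sum of the one-step second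
moments, hence of order `τ` and not `τ²`. Telescoping over rounds and Jensen's inequality finish the
bound, except for a leftover of order `ηV`, where `V` is the damped variance. The lower bound on the
step size turns this into order `Lτ²η²V`. -/

namespace ADPQFL

/-! ### Smooth convex functions: tangent bounds, co-coercivity, optimality -/

section Convex

variable {d : ℕ}

theorem hasDerivAt_comp_line {f : Param d → ℝ} (hf : Differentiable ℝ f) (x v : Param d) (t : ℝ) :
    HasDerivAt (fun s : ℝ => f (x + s • v)) (inner ℝ (gradient f (x + t • v)) v) t := by
  have h1 : HasDerivAt (fun s : ℝ => x + s • v) v t := by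
    simpa using ((hasDerivAt_id t).smul_const v).const_add x
  have h2 := (hf (x + t • v)).hasGradientAt.hasFDerivAt
  exact (h2.comp_hasDerivAt t h1).congr_deriv (InnerProductSpace.toDual_apply_apply ..)

/-- Along the segment, subtracting the linear and quadratic terms leaves a function whose derivative
is nonpositive on the open unit interval; the mean value theorem compares its endpoints. -/
theorem IsLSmooth.le_quadratic {L : ℝ} {f : Param d → ℝ} (hf : IsLSmooth L f) (x y : Param d) :
    f y ≤ f x + inner ℝ (gradient f x) (y - x) + L / 2 * ‖y - x‖ ^ 2 := by
  set v := y - x with hv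
  have hd : ∀ t : ℝ, HasDerivAt
      (fun s : ℝ => f (x + s • v) - s * inner ℝ (gradient f x) v - L / 2 * ‖v‖ ^ 2 * s ^ 2)
      (inner ℝ (gradient f (x + t • v)) v - inner ℝ (gradient f x) v
        - L / 2 * ‖v‖ ^ 2 * (2 * t)) t := by
    intro t
    have h := ((hasDerivAt_comp_line hf.differentiable x v t).sub
      ((hasDerivAt_id t).mul_const (inner ℝ (gradient f x) v))).sub
      (((hasDerivAt_id t).pow 2).const_mul (L / 2 * ‖v‖ ^ 2))
    exact h.congr_deriv (by simp)
  obtain ⟨c, hc, hce⟩ := exists_hasDerivAt_eq_slope _ _ (zero_lt_one' ℝ)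
    (HasDerivAt.continuousOn fun t _ => hd t) (fun t _ => hd t)
  have hle : inner ℝ (gradient f (x + c • v)) v - inner ℝ (gradient f x) v
      ≤ L * c * ‖v‖ ^ 2 := by
    rw [← inner_sub_left]
    refine (real_inner_le_norm _ _).trans ?_
    have h := hf.lipschitz (x + c • v) x
    rw [add_sub_cancel_left, norm_smul, Real.norm_of_nonneg hc.1.le] at h
    nlinarith [norm_nonneg v, mul_le_mul_of_nonneg_right h (norm_nonneg v)]
  have hy : x + (1 : ℝ) • v = y := by simp [hv]
  rw [hy] at hce
  simp only [zero_smul, add_zero, one_mul, zero_mul, sub_zero, div_one] at hce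
  nlinarith

theorem add_inner_gradient_le_of_monotone {f : Param d → ℝ} (hf : Differentiable ℝ f)
    (hmono : ∀ w w' : Param d, 0 ≤ inner ℝ (gradient f w - gradient f w') (w - w'))
    (x y : Param d) : f x + inner ℝ (gradient f x) (y - x) ≤ f y := by
  set v := y - x with hv
  obtain ⟨c, hc, hce⟩ := exists_hasDerivAt_eq_slope (fun s : ℝ => f (x + s • v)) _
    (zero_lt_one' ℝ) (HasDerivAt.continuousOn fun t _ => hasDerivAt_comp_line hf x v t)
    (fun t _ => hasDerivAt_comp_line hf x v t)
  have hy : x + (1 : ℝ) • v = y := by simp [hv]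
  rw [hy] at hce
  have h := hmono (x + c • v) x
  rw [add_sub_cancel_left, inner_smul_right, inner_sub_left] at h
  have h' := nonneg_of_mul_nonneg_right h hc.1
  simp only [zero_smul, add_zero, sub_zero, div_one] at hce
  linarith

theorem IsMStronglyConvex.add_inner_gradient_le {m : ℝ} {f : Param d → ℝ}
    (hf : IsMStronglyConvex m f) (hm : 0 ≤ m) (x y : Param d) :
    f x + inner ℝ (gradient f x) (y - x) ≤ f y :=
  add_inner_gradient_le_of_monotone hf.differentiable
    (fun w w' => le_trans (by positivity) (hf.strongly_monotone w w')) x y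

/-- Co-coercivity: at the gradient-step point `x - D / L`, the tangent plane at `y` lies below the
quadratic upper bound at `x`; this choice of point minimizes the latter minus the former. -/
theorem IsLSmooth.norm_gradient_sub_sq_le {L : ℝ} {f : Param d → ℝ} (hL : 0 < L)
    (hf : IsLSmooth L f) (hc : ∀ x y, f x + inner ℝ (gradient f x) (y - x) ≤ f y)
    (x y : Param d) :
    ‖gradient f x - gradient f y‖ ^ 2
      ≤ 2 * L * (f x - f y - inner ℝ (gradient f y) (x - y)) := by
  set D := gradient f x - gradient f y with hD
  set z := x - (1 / L) • D with hz
  have h1 := hc y z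
  have h2 := hf.le_quadratic x z
  have hzx : z - x = -((1 / L) • D) := by simp [hz]
  have hzy : z - y = (x - y) - (1 / L) • D := by rw [hz]; abel
  rw [hzy, inner_sub_right, inner_smul_right] at h1
  rw [hzx, inner_neg_right, inner_smul_right, norm_neg, norm_smul,
    Real.norm_of_nonneg (by positivity : (0 : ℝ) ≤ 1 / L)] at h2
  have h3 : inner ℝ (gradient f x) D - inner ℝ (gradient f y) D = ‖D‖ ^ 2 := by
    rw [← inner_sub_left, ← hD, real_inner_self_eq_norm_sq]
  have h4 : 1 / L * ‖D‖ ^ 2 - L / 2 * (1 / L * ‖D‖) ^ 2 = ‖D‖ ^ 2 / (2 * L) := by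
    field_simp; ring
  have h5 : ‖D‖ ^ 2 / (2 * L) ≤ f x - f y - inner ℝ (gradient f y) (x - y) := by
    rw [← h4, ← h3]; linarith
  rw [div_le_iff₀ (by positivity)] at h5
  linarith

theorem IsLSmooth.lipschitzWith_gradient {L : ℝ} {f : Param d → ℝ} (hf : IsLSmooth L f) :
    LipschitzWith L.toNNReal (gradient f) := by
  refine LipschitzWith.of_dist_le_mul fun x y => ?_
  rw [dist_eq_norm, dist_eq_norm]
  exact (hf.lipschitz x y).trans
    (mul_le_mul_of_nonneg_right (Real.le_coe_toNNReal L) (norm_nonneg _))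

theorem sum_gradient_eq_zero_of_isMin {U : ℕ} (hU : 1 ≤ U) {F : Fin U → Param d → ℝ}
    (hF : ∀ u, Differentiable ℝ (F u)) {θs : Param d}
    (hmin : ∀ θ, globalLoss F θs ≤ globalLoss F θ) : ∑ u, gradient (F u) θs = 0 := by
  -- Moving in the direction of the gradient sum itself makes the derivative at the minimum equal to
  -- `‖v‖ ^ 2`.
  set v := ∑ u, gradient (F u) θs with hv
  have hd : HasDerivAt (fun s : ℝ => ∑ u, F u (θs + s • v))
      (∑ u, inner ℝ (gradient (F u) (θs + (0 : ℝ) • v)) v) 0 :=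
    HasDerivAt.fun_sum fun u _ => hasDerivAt_comp_line (hF u) θs v 0
  have hU' : (0 : ℝ) < 1 / U := by positivity
  have hloc : IsLocalMin (fun s : ℝ => ∑ u, F u (θs + s • v)) 0 := by
    refine Filter.Eventually.of_forall fun s => ?_
    have := le_of_mul_le_mul_left (hmin (θs + s • v)) hU'
    simpa using this
  have h0 := hloc.hasDerivAt_eq_zero hd
  simp only [zero_smul, add_zero] at h0
  rw [← sum_inner, ← hv] at h0
  simpa using h0

end Convex

/-! ### Norms of sums and averages -/

section Averages

variable {E : Type*} [NormedAddCommGroup E]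

theorem norm_sum_sq_le {ι : Type*} (s : Finset ι) (v : ι → E) :
    ‖∑ i ∈ s, v i‖ ^ 2 ≤ s.card * ∑ i ∈ s, ‖v i‖ ^ 2 :=
  (pow_le_pow_left₀ (norm_nonneg _) (norm_sum_le _ _) 2).trans sq_sum_le_card_mul_sum_sq

theorem norm_average_sq_le [NormedSpace ℝ E] {N : ℕ} (v : Fin N → E) :
    ‖(1 / (N : ℝ)) • ∑ i, v i‖ ^ 2 ≤ (1 / (N : ℝ)) * ∑ i, ‖v i‖ ^ 2 := by
  rcases Nat.eq_zero_or_pos N with rfl | hN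
  · simp
  have hN' : (0 : ℝ) < N := by exact_mod_cast hN
  rw [norm_smul, Real.norm_of_nonneg (by positivity), mul_pow]
  have h := norm_sum_sq_le Finset.univ v
  rw [Finset.card_univ, Fintype.card_fin] at h
  calc (1 / (N : ℝ)) ^ 2 * ‖∑ i, v i‖ ^ 2 ≤ (1 / (N : ℝ)) ^ 2 * (N * ∑ i, ‖v i‖ ^ 2) := by gcongr
    _ = _ := by field_simp

theorem norm_add_sq_le (a b : E) : ‖a + b‖ ^ 2 ≤ 2 * ‖a‖ ^ 2 + 2 * ‖b‖ ^ 2 := by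
  nlinarith [norm_add_le a b, norm_nonneg (a + b), norm_nonneg a, norm_nonneg b,
    sq_nonneg (‖a‖ - ‖b‖)]

end Averages

/-! ### Deterministic analysis of one round -/

section Round

variable {d : ℕ}

/-- A perturbed gradient descent path: `ξ k` is the error of the gradient at step `k`. -/
structure IsNoisyDescent (η : ℝ) (f : Param d → ℝ) (ξ : ℕ → Param d) (θ : Param d)
    (x : ℕ → Param d) : Prop where
  zero : x 0 = θ
  succ : ∀ k, x (k + 1) = x k - η • (gradient f (x k) + ξ k)

theorem IsNoisyDescent.eq_sub_sum {η : ℝ} {f : Param d → ℝ} {ξ : ℕ → Param d} {θ : Param d}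
    {x : ℕ → Param d} (h : IsNoisyDescent η f ξ θ x) (k : ℕ) :
    x k = θ - η • ∑ j ∈ Finset.range k, (gradient f (x j) + ξ j) := by
  induction k with
  | zero => simp [h.zero]
  | succ k ih =>
    rw [h.succ, Finset.sum_range_succ, smul_add _ (Finset.sum _ _), ← sub_sub, ← ih]

/-- Client drift. The increments depend on the drift through Lipschitz continuity, so the estimate
bounds the drift sum by itself plus a source; small `ητL` lets it be absorbed. -/
theorem IsNoisyDescent.sum_norm_sub_sq_le {η L : ℝ} {f : Param d → ℝ} {ξ : ℕ → Param d}
    {θ : Param d} {x : ℕ → Param d} (h : IsNoisyDescent η f ξ θ x) (hf : IsLSmooth L f)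
    (hL : 0 ≤ L) (hη : 0 ≤ η) {τ : ℕ} (hτ : η * τ * L ≤ 1 / 6) (θs : Param d) :
    ∑ k ∈ Finset.range τ, ‖x k - θ‖ ^ 2 ≤ 9 / 2 * η ^ 2 * τ ^ 2 *
      (τ * ‖gradient f θ - gradient f θs‖ ^ 2 + τ * ‖gradient f θs‖ ^ 2
        + ∑ k ∈ Finset.range τ, ‖ξ k‖ ^ 2) := by
  set S := ∑ k ∈ Finset.range τ, ‖x k - θ‖ ^ 2 with hS
  set A := ‖gradient f θ - gradient f θs‖ ^ 2 with hA
  set B := ‖gradient f θs‖ ^ 2 with hB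
  set Q := ∑ k ∈ Finset.range τ, ‖ξ k‖ ^ 2 with hQ
  have hS0 : 0 ≤ S := Finset.sum_nonneg fun _ _ => by positivity
  have hstep : ∀ j, ‖gradient f (x j) + ξ j‖ ^ 2
      ≤ 4 * (L ^ 2 * ‖x j - θ‖ ^ 2) + 4 * A + 4 * B + 4 * ‖ξ j‖ ^ 2 := by
    intro j
    have h1 := norm_add_sq_le
      ((gradient f (x j) - gradient f θ) + (gradient f θ - gradient f θs)) (gradient f θs + ξ j)
    have h2 := norm_add_sq_le (gradient f (x j) - gradient f θ) (gradient f θ - gradient f θs)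
    have h3 := norm_add_sq_le (gradient f θs) (ξ j)
    have h4 := pow_le_pow_left₀ (norm_nonneg _) (hf.lipschitz (x j) θ) 2
    rw [mul_pow] at h4
    have h5 : (gradient f (x j) - gradient f θ) + (gradient f θ - gradient f θs)
      + (gradient f θs + ξ j) = gradient f (x j) + ξ j := by abel
    rw [h5] at h1
    linarith
  have hsum : ∑ j ∈ Finset.range τ, ‖gradient f (x j) + ξ j‖ ^ 2
      ≤ 4 * L ^ 2 * S + 4 * (τ * A + τ * B + Q) := by
    refine (Finset.sum_le_sum fun j _ => hstep j).trans (le_of_eq ?_)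
    simp only [Finset.sum_add_distrib, ← Finset.mul_sum, Finset.sum_const, Finset.card_range,
      nsmul_eq_mul, ← hS, ← hQ]
    ring
  have hk : ∀ k ∈ Finset.range τ, ‖x k - θ‖ ^ 2
      ≤ η ^ 2 * (τ * (4 * L ^ 2 * S + 4 * (τ * A + τ * B + Q))) := by
    intro k hk
    have hkτ : k ≤ τ := (Finset.mem_range.1 hk).le
    rw [h.eq_sub_sum k, sub_sub_cancel_left, norm_neg, norm_smul, mul_pow, Real.norm_eq_abs,
      sq_abs]
    refine mul_le_mul_of_nonneg_left ?_ (sq_nonneg η)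
    have h1 := norm_sum_sq_le (Finset.range k) fun j => gradient f (x j) + ξ j
    rw [Finset.card_range] at h1
    refine h1.trans (mul_le_mul (by exact_mod_cast hkτ) (le_trans ?_ hsum)
      (Finset.sum_nonneg fun _ _ => by positivity) (by positivity))
    exact Finset.sum_le_sum_of_subset_of_nonneg (Finset.range_mono hkτ)
      fun _ _ _ => by positivity
  have hfin := Finset.sum_le_sum hk
  rw [Finset.sum_const, Finset.card_range, nsmul_eq_mul, ← hS] at hfin
  -- The self-term is `4 (ητL)² S ≤ S / 9`; moving it to the left turns the factor 4 into `4 · 9/8 =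
  -- 9/2`.
  have hsmall : (η * τ * L) ^ 2 ≤ (1 / 6) ^ 2 := pow_le_pow_left₀ (by positivity) hτ 2
  have := mul_le_mul_of_nonneg_right hsmall hS0
  linarith

/-- Split `θ - θs` at each iterate: smoothness handles the part from `x k` to `θ` at the cost of a
squared distance, convexity the part from `θs` to `x k`. -/
theorem IsLSmooth.inner_sum_gradient_ge {L : ℝ} {f : Param d → ℝ}
    {θ : Param d} (hf : IsLSmooth L f) (x : ℕ → Param d)
    (hc : ∀ x y, f x + inner ℝ (gradient f x) (y - x) ≤ f y) (τ : ℕ) (θs : Param d) :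
    τ * (f θ - f θs) - L / 2 * ∑ k ∈ Finset.range τ, ‖x k - θ‖ ^ 2
      ≤ inner ℝ (θ - θs) (∑ k ∈ Finset.range τ, gradient f (x k)) := by
  have h0 : τ * (f θ - f θs) = ∑ _k ∈ Finset.range τ, (f θ - f θs) := by
    rw [Finset.sum_const, Finset.card_range, nsmul_eq_mul]
  rw [inner_sum, Finset.mul_sum, h0, ← Finset.sum_sub_distrib]
  refine Finset.sum_le_sum fun k _ => ?_
  have h1 := hc (x k) θs
  have h2 := hf.le_quadratic (x k) θ
  have h3 : θ - θs = (θ - x k) - (θs - x k) := by abel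
  rw [h3, real_inner_comm, inner_sub_right, norm_sub_rev (x k)]
  linarith

theorem average_norm_gradient_sub_sq_le {U : ℕ} (hU : 1 ≤ U) {L : ℝ} (hL : 0 < L)
    {F : Fin U → Param d → ℝ} (hF : ∀ u, IsLSmooth L (F u))
    (hc : ∀ u x y, F u x + inner ℝ (gradient (F u) x) (y - x) ≤ F u y) {θs : Param d}
    (hmin : ∀ θ, globalLoss F θs ≤ globalLoss F θ) (θ : Param d) :
    (1 / (U : ℝ)) * ∑ u, ‖gradient (F u) θ - gradient (F u) θs‖ ^ 2
      ≤ 2 * L * (globalLoss F θ - globalLoss F θs) := by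
  have h := Finset.sum_le_sum fun (u : Fin U) (_ : u ∈ Finset.univ) =>
    (hF u).norm_gradient_sub_sq_le hL (hc u) θ θs
  rw [← Finset.mul_sum, Finset.sum_sub_distrib, Finset.sum_sub_distrib, ← sum_inner,
    sum_gradient_eq_zero_of_isMin hU (fun u => (hF u).differentiable) hmin, inner_zero_left,
    sub_zero] at h
  have h' := mul_le_mul_of_nonneg_left h (by positivity : (0 : ℝ) ≤ 1 / U)
  unfold globalLoss
  linarith

theorem norm_average_sum_gradient_sq_le {U : ℕ} (hU : 1 ≤ U) {L : ℝ} (hL : 0 < L)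
    {F : Fin U → Param d → ℝ} (hF : ∀ u, IsLSmooth L (F u))
    (hc : ∀ u x y, F u x + inner ℝ (gradient (F u) x) (y - x) ≤ F u y) {θs : Param d}
    (hmin : ∀ θ, globalLoss F θs ≤ globalLoss F θ) (θ : Param d) (x : Fin U → ℕ → Param d)
    (τ : ℕ) :
    ‖(1 / (U : ℝ)) • ∑ u, ∑ k ∈ Finset.range τ, gradient (F u) (x u k)‖ ^ 2
      ≤ 2 * τ * L ^ 2 * ((1 / (U : ℝ)) * ∑ u, ∑ k ∈ Finset.range τ, ‖x u k - θ‖ ^ 2)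
        + 4 * τ ^ 2 * L * (globalLoss F θ - globalLoss F θs) := by
  have hA := average_norm_gradient_sub_sq_le hU hL hF hc hmin θ
  have hzero := sum_gradient_eq_zero_of_isMin hU (fun u => (hF u).differentiable) hmin
  -- Gradients at `θs` sum to zero over the clients, so they may be subtracted freely: one summand
  -- measures drift, the other the optimality gap.
  have hsplit : (1 / (U : ℝ)) • ∑ u, ∑ k ∈ Finset.range τ, gradient (F u) (x u k)
      = (1 / (U : ℝ)) • ∑ u, ∑ k ∈ Finset.range τ, (gradient (F u) (x u k) - gradient (F u) θ)
        + (τ : ℝ) • ((1 / (U : ℝ)) • ∑ u, (gradient (F u) θ - gradient (F u) θs)) := by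
    rw [Finset.sum_sub_distrib, hzero, sub_zero, smul_comm, ← smul_add]
    congr 1
    rw [Finset.smul_sum, ← Finset.sum_add_distrib]
    refine Finset.sum_congr rfl fun u _ => ?_
    rw [Finset.sum_sub_distrib, Finset.sum_const, Finset.card_range, ← Nat.cast_smul_eq_nsmul ℝ]
    abel
  have h1 : ‖(1 / (U : ℝ)) • ∑ u, ∑ k ∈ Finset.range τ,
      (gradient (F u) (x u k) - gradient (F u) θ)‖ ^ 2
      ≤ τ * L ^ 2 * ((1 / (U : ℝ)) * ∑ u, ∑ k ∈ Finset.range τ, ‖x u k - θ‖ ^ 2) := by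
    refine (norm_average_sq_le _).trans ?_
    rw [mul_left_comm]
    refine mul_le_mul_of_nonneg_left ?_ (by positivity)
    rw [Finset.mul_sum]
    refine Finset.sum_le_sum fun u _ => (norm_sum_sq_le _ _).trans ?_
    rw [Finset.card_range, mul_assoc, Finset.mul_sum (a := L ^ 2)]
    refine mul_le_mul_of_nonneg_left (Finset.sum_le_sum fun k _ => ?_) (by positivity)
    rw [← mul_pow]
    exact pow_le_pow_left₀ (norm_nonneg _) ((hF u).lipschitz _ _) 2
  have h2 : ‖(τ : ℝ) • ((1 / (U : ℝ)) • ∑ u, (gradient (F u) θ - gradient (F u) θs))‖ ^ 2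
      ≤ τ ^ 2 * (2 * L * (globalLoss F θ - globalLoss F θs)) := by
    rw [norm_smul, mul_pow, Real.norm_natCast]
    exact mul_le_mul_of_nonneg_left ((norm_average_sq_le _).trans hA) (by positivity)
  rw [hsplit]
  refine (norm_add_sq_le _ _).trans ?_
  linarith

theorem norm_average_noisyDescent_sub_sq_le {U : ℕ} (hU : 1 ≤ U) {L η σs : ℝ} (hL : 0 < L)
    (hη : 0 < η) {τ : ℕ} (hτ : η * τ * L ≤ 1 / 6)
    {F : Fin U → Param d → ℝ} (hF : ∀ u, IsLSmooth L (F u))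
    (hc : ∀ u x y, F u x + inner ℝ (gradient (F u) x) (y - x) ≤ F u y) {θs : Param d}
    (hmin : ∀ θ, globalLoss F θs ≤ globalLoss F θ)
    (hσs : (1 / (U : ℝ)) * ∑ u, ‖gradient (F u) θs‖ ^ 2 ≤ σs ^ 2)
    {θ : Param d} {ξ x : Fin U → ℕ → Param d}
    (hx : ∀ u, IsNoisyDescent η (F u) (ξ u) θ (x u)) :
    ‖(1 / (U : ℝ)) • ∑ u, x u τ - θs‖ ^ 2 ≤ ‖θ - θs‖ ^ 2
      - 1 / 4 * η * τ * (globalLoss F θ - globalLoss F θs)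
      + 15 / 2 * η ^ 3 * τ ^ 2 * L * (τ * σs ^ 2
        + (1 / (U : ℝ)) * ∑ u, ∑ k ∈ Finset.range τ, ‖ξ u k‖ ^ 2)
      + 2 * η ^ 2 * ‖∑ k ∈ Finset.range τ, (1 / (U : ℝ)) • ∑ u, ξ u k‖ ^ 2
      - 2 * η * inner ℝ (θ - θs) (∑ k ∈ Finset.range τ, (1 / (U : ℝ)) • ∑ u, ξ u k) := by
  have hU0 : (0 : ℝ) < U := by exact_mod_cast hU
  have ha : (0 : ℝ) ≤ 1 / U := by positivity
  have hA := average_norm_gradient_sub_sq_le hU hL hF hc hmin θ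
  have hD := norm_average_sum_gradient_sq_le hU hL hF hc hmin θ x τ
  have hδ : 0 ≤ globalLoss F θ - globalLoss F θs := sub_nonneg.2 (hmin θ)
  have hS : (1 / (U : ℝ)) * ∑ u, ∑ k ∈ Finset.range τ, ‖x u k - θ‖ ^ 2
      ≤ 9 / 2 * η ^ 2 * τ ^ 2 * (τ * (2 * L * (globalLoss F θ - globalLoss F θs))
        + τ * σs ^ 2 + (1 / (U : ℝ)) * ∑ u, ∑ k ∈ Finset.range τ, ‖ξ u k‖ ^ 2) := by
    have h := mul_le_mul_of_nonneg_left (Finset.sum_le_sum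
      fun (u : Fin U) (_ : u ∈ Finset.univ) =>
        (hx u).sum_norm_sub_sq_le (hF u) hL.le hη.le hτ θs) ha
    rw [← Finset.mul_sum, Finset.sum_add_distrib, Finset.sum_add_distrib, ← Finset.mul_sum,
      ← Finset.mul_sum, mul_left_comm] at h
    refine h.trans (mul_le_mul_of_nonneg_left ?_ (by positivity))
    rw [mul_add, mul_add, mul_left_comm, mul_left_comm _ (τ : ℝ)]
    gcongr
  have hI : τ * (globalLoss F θ - globalLoss F θs)
      - L / 2 * ((1 / (U : ℝ)) * ∑ u, ∑ k ∈ Finset.range τ, ‖x u k - θ‖ ^ 2)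
      ≤ inner ℝ (θ - θs)
        ((1 / (U : ℝ)) • ∑ u, ∑ k ∈ Finset.range τ, gradient (F u) (x u k)) := by
    have h := mul_le_mul_of_nonneg_left (Finset.sum_le_sum
      fun (u : Fin U) (_ : u ∈ Finset.univ) =>
        (hF u).inner_sum_gradient_ge (θ := θ) (x u) (hc u) τ θs) ha
    rw [Finset.sum_sub_distrib, ← Finset.mul_sum, ← Finset.mul_sum, Finset.sum_sub_distrib,
      ← inner_sum] at h
    rw [inner_smul_right]
    refine le_trans (le_of_eq ?_) h
    unfold globalLoss
    ring
  have hupd : (1 / (U : ℝ)) • ∑ u, x u τ - θs = (θ - θs)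
      - η • ((1 / (U : ℝ)) • ∑ u, ∑ k ∈ Finset.range τ, gradient (F u) (x u k)
        + ∑ k ∈ Finset.range τ, (1 / (U : ℝ)) • ∑ u, ξ u k) := by
    have h1 : ∑ u, x u τ = (U : ℝ) • θ - η • (∑ u, ∑ k ∈ Finset.range τ, gradient (F u) (x u k)
        + ∑ k ∈ Finset.range τ, ∑ u, ξ u k) := by
      rw [Finset.sum_congr rfl fun u _ => (hx u).eq_sub_sum τ, Finset.sum_sub_distrib,
        Finset.sum_const, Finset.card_univ, Fintype.card_fin, ← Nat.cast_smul_eq_nsmul ℝ,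
        ← Finset.smul_sum, Finset.sum_comm (γ := ℕ), ← Finset.sum_add_distrib]
      simp_rw [← Finset.sum_add_distrib]
    rw [h1, ← Finset.smul_sum, ← smul_add, smul_sub, smul_smul, one_div_mul_cancel hU0.ne',
      one_smul, smul_comm η]
    abel
  set D := (1 / (U : ℝ)) • ∑ u, ∑ k ∈ Finset.range τ, gradient (F u) (x u k)
  set Ξ := ∑ k ∈ Finset.range τ, (1 / (U : ℝ)) • ∑ u, ξ u k
  set S := (1 / (U : ℝ)) * ∑ u, ∑ k ∈ Finset.range τ, ‖x u k - θ‖ ^ 2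
  set Q := (1 / (U : ℝ)) * ∑ u, ∑ k ∈ Finset.range τ, ‖ξ u k‖ ^ 2
  set δ := globalLoss F θ - globalLoss F θs
  have hS0 : 0 ≤ S := mul_nonneg ha (Finset.sum_nonneg fun _ _ => Finset.sum_nonneg
    fun _ _ => by positivity)
  have hsq := norm_add_sq_le D Ξ
  -- `D` depends on noise from earlier steps of the round, so its cross term with `Ξ` is not
  -- discarded by orthogonality but absorbed into `hsq`.
  rw [hupd, norm_sub_sq_real, inner_smul_right, inner_add_right, norm_smul, mul_pow,
    Real.norm_eq_abs, sq_abs]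
  have e1 : η ^ 2 * ‖D + Ξ‖ ^ 2 ≤ η ^ 2 * (2 * (2 * τ * L ^ 2 * S + 4 * τ ^ 2 * L * δ)
      + 2 * ‖Ξ‖ ^ 2) := mul_le_mul_of_nonneg_left (by linarith) (sq_nonneg η)
  have e2 := mul_le_mul_of_nonneg_left hI hη.le
  have e3 : (η * τ * L) * (η * L * S) ≤ 1 / 6 * (η * L * S) :=
    mul_le_mul_of_nonneg_right hτ (by positivity)
  have e4 : (η * τ * L) * (η * τ * δ) ≤ 1 / 6 * (η * τ * δ) :=
    mul_le_mul_of_nonneg_right hτ (by positivity)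
  have e5 : (η * τ * L) ^ 2 * (η * τ * δ) ≤ (1 / 6) ^ 2 * (η * τ * δ) :=
    mul_le_mul_of_nonneg_right (pow_le_pow_left₀ (by positivity) hτ 2) (by positivity)
  -- The coefficient of `S` is `ηL` from `hI` plus `4η²τL² ≤ (2/3) ηL` from `hD`. With the drift
  -- bound, the coefficient of `ητδ` becomes `-2 + 4/3 + 5/12 = -1/4`.
  have e6 := mul_le_mul_of_nonneg_left hS (by positivity : 0 ≤ 5 / 3 * (η * L))
  linarith

end Round

/-! ### Orthogonality of conditionally centred noise -/

section Orthogonality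

variable {E Ω : Type*} [NormedAddCommGroup E] [InnerProductSpace ℝ E]
  {m mΩ : MeasurableSpace Ω} {P : Measure Ω}

theorem integrable_inner_of_memLp_two {f g : Ω → E} (hf : MemLp f 2 P) (hg : MemLp g 2 P) :
    Integrable (fun ω => inner ℝ (f ω) (g ω)) P := by
  refine ((hf.integrable_norm_pow (p := 2) two_ne_zero).add
    (hg.integrable_norm_pow (p := 2) two_ne_zero)).mono'
    (hf.aestronglyMeasurable.inner hg.aestronglyMeasurable) (Filter.Eventually.of_forall fun ω => ?_)
  have := norm_inner_le_norm (𝕜 := ℝ) (f ω) (g ω)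
  simp only [Pi.add_apply]
  nlinarith [sq_nonneg (‖f ω‖ - ‖g ω‖), sq_nonneg (‖f ω‖), sq_nonneg (‖g ω‖)]

variable [CompleteSpace E] [IsProbabilityMeasure P]

theorem integral_inner_eq_zero_of_condExp_eq_zero (hm : m ≤ mΩ) {f g : Ω → E}
    (hfm : StronglyMeasurable[m] f) (hf : MemLp f 2 P) (hg : MemLp g 2 P)
    (hg0 : P[g | m] =ᵐ[P] 0) : ∫ ω, inner ℝ (f ω) (g ω) ∂P = 0 := by
  -- The known factor pulls out of the conditional expectation.
  have h := condExp_bilin_of_stronglyMeasurable_left (B := innerSL ℝ) hfm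
    (integrable_inner_of_memLp_two hf hg) (hg.integrable one_le_two)
  have h' : P[fun ω => inner ℝ (f ω) (g ω) | m] =ᵐ[P] 0 := by
    refine h.trans ?_
    filter_upwards [hg0] with ω hω
    simp [hω]
  rw [← integral_condExp hm, integral_congr_ae h']
  simp

variable {𝓕 : Filtration ℕ mΩ} {ζ : ℕ → Ω → E} {s τ : ℕ}

theorem integral_inner_sum_eq_zero (hζ : ∀ k < τ, MemLp (ζ k) 2 P)
    (h0 : ∀ k < τ, P[ζ k | 𝓕 (s + k)] =ᵐ[P] 0) {f : Ω → E}
    (hfm : StronglyMeasurable[𝓕 s] f) (hf : MemLp f 2 P) :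
    ∫ ω, inner ℝ (f ω) (∑ k ∈ Finset.range τ, ζ k ω) ∂P = 0 := by
  simp_rw [inner_sum]
  rw [integral_finsetSum _ fun k hk =>
    integrable_inner_of_memLp_two hf (hζ k (Finset.mem_range.1 hk))]
  refine Finset.sum_eq_zero fun k hk => ?_
  have hk := Finset.mem_range.1 hk
  exact integral_inner_eq_zero_of_condExp_eq_zero (𝓕.le _)
    (hfm.mono (𝓕.mono (Nat.le_add_right s k))) hf (hζ k hk) (h0 k hk)

/-- Each partial sum is known before the next increment, so all cross terms have zero mean. -/
theorem integral_norm_sum_sq_eq (hm : ∀ k < τ, StronglyMeasurable[𝓕 (s + k + 1)] (ζ k))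
    (hζ : ∀ k < τ, MemLp (ζ k) 2 P) (h0 : ∀ k < τ, P[ζ k | 𝓕 (s + k)] =ᵐ[P] 0) :
    ∫ ω, ‖∑ k ∈ Finset.range τ, ζ k ω‖ ^ 2 ∂P
      = ∑ k ∈ Finset.range τ, ∫ ω, ‖ζ k ω‖ ^ 2 ∂P := by
  induction τ with
  | zero => simp
  | succ τ ih =>
    have ih := ih (fun k hk => hm k (by omega)) (fun k hk => hζ k (by omega))
      (fun k hk => h0 k (by omega))
    have hS : MemLp (fun ω => ∑ k ∈ Finset.range τ, ζ k ω) 2 P :=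
      memLp_finsetSum _ fun k hk => hζ k (by have := Finset.mem_range.1 hk; omega)
    have hSm : StronglyMeasurable[𝓕 (s + τ)] (fun ω => ∑ k ∈ Finset.range τ, ζ k ω) := by
      refine Finset.stronglyMeasurable_fun_sum _ fun k hk => ?_
      have := Finset.mem_range.1 hk
      exact (hm k (by omega)).mono (𝓕.mono (by omega))
    have hτ := hζ τ (by omega)
    have hz := integral_inner_eq_zero_of_condExp_eq_zero (𝓕.le _) hSm hS hτ (h0 τ (by omega))
    simp_rw [Finset.sum_range_succ, norm_add_sq_real]
    have i1 : Integrable (fun ω => ‖∑ k ∈ Finset.range τ, ζ k ω‖ ^ 2) P :=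
      hS.integrable_norm_pow (p := 2) two_ne_zero
    have i2 := (integrable_inner_of_memLp_two hS hτ).const_mul 2
    have i3 := hτ.integrable_norm_pow (p := 2) two_ne_zero
    rw [integral_add (f := fun ω => ‖∑ k ∈ Finset.range τ, ζ k ω‖ ^ 2
      + 2 * inner ℝ (∑ k ∈ Finset.range τ, ζ k ω) (ζ τ ω)) (i1.add i2) i3, integral_add i1 i2, integral_const_mul, hz, ih]
    ring

end Orthogonality

/-- A Lipschitz map vanishing at 0 preserves square-integrability; the constant `gradient f 0` is
removed and then restored. -/
theorem IsLSmooth.memLp_gradient_comp {d : ℕ} {Ω : Type*} {mΩ : MeasurableSpace Ω} {P : Measure Ω}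
    [IsFiniteMeasure P] {L : ℝ} {f : Param d → ℝ}
    (hf : IsLSmooth L f) {x : Ω → Param d}
    (hx : MemLp x 2 P) : MemLp (fun ω => gradient f (x ω)) 2 P := by
  have hlip : LipschitzWith L.toNNReal (fun w => gradient f w - gradient f 0) := by
    refine LipschitzWith.of_dist_le_mul fun w w' => ?_
    simpa using hf.lipschitzWith_gradient.dist_le_mul w w'
  have h := (hlip.comp_memLp (sub_self _) hx).add (memLp_const (gradient f 0))
  refine h.ae_eq (Filter.Eventually.of_forall fun ω => ?_)
  simp

/-! ### Measurability, moments and noise along a run -/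

section Run

variable {d U n τ : ℕ} {N : Fin U → ℕ} {η : ℝ} {F : Fin U → Param d → ℝ} {θ₀ : Param d}
  {Ω : Type*}

/-- The deviation of the `n`-qubit gradient of client `u` from the exact gradient at local step
`k` of round `t`, on the outcome `ω`. -/
noncomputable def gradientNoise (n τ : ℕ) (η : ℝ) (F : Fin U → Param d → ℝ)
    (g : ℕ → ℕ → (u : Fin U) → Fin (N u) → Ω → Param d) (θ₀ : Param d)
    (t k : ℕ) (u : Fin U) (ω : Ω) : Param d :=
  √(3 / ((2 : ℝ) ^ (2 * n) - 1)) • ((1 / (N u : ℝ)) • ∑ i, (g t k u i ω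
    - gradient (F u) (clientModel n τ η F (fun t k u i => g t k u i ω) θ₀ t k u)))

theorem isNoisyDescent_clientModel (n τ : ℕ) (η : ℝ) (F : Fin U → Param d → ℝ)
    (g : ℕ → ℕ → (u : Fin U) → Fin (N u) → Ω → Param d) (θ₀ : Param d) (t : ℕ) (u : Fin U)
    (ω : Ω) :
    IsNoisyDescent η (F u) (fun k => gradientNoise n τ η F g θ₀ t k u ω)
      (globalModel n τ η F (fun t k u i => g t k u i ω) θ₀ t)
      (fun k => clientModel n τ η F (fun t k u i => g t k u i ω) θ₀ t k u) :=
  ⟨rfl, fun _ => rfl⟩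

variable {mΩ : MeasurableSpace Ω} {P : Measure Ω}
  {𝓕 : Filtration ℕ mΩ} {g : ℕ → ℕ → (u : Fin U) → Fin (N u) → Ω → Param d} {σ L : ℝ}

variable (hg : IsStochasticGradient P 𝓕 n τ η F g θ₀ σ) (hF : ∀ u, IsLSmooth L (F u))
include hg hF

theorem stronglyMeasurable_gradientNoise_of_clientModel {t k : ℕ} (hk : k < τ) {u : Fin U}
    (h : StronglyMeasurable[𝓕 (t * τ + k)]
      (fun ω => clientModel n τ η F (fun t k u i => g t k u i ω) θ₀ t k u)) :
    StronglyMeasurable[𝓕 (t * τ + k + 1)] (gradientNoise n τ η F g θ₀ t k u) := by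
  refine StronglyMeasurable.fun_const_smul (StronglyMeasurable.fun_const_smul
    (Finset.stronglyMeasurable_fun_sum _ fun i _ => (hg.adapted t k hk u i).sub ?_)
    (1 / (N u : ℝ))) √(3 / ((2 : ℝ) ^ (2 * n) - 1))
  exact ((hF u).lipschitzWith_gradient.continuous.comp_stronglyMeasurable h).mono
    (𝓕.mono (Nat.le_succ _))

variable [IsProbabilityMeasure P]

theorem memLp_gradientNoise_of_clientModel {t k : ℕ} (hk : k < τ) {u : Fin U}
    (h : MemLp (fun ω => clientModel n τ η F (fun t k u i => g t k u i ω) θ₀ t k u) 2 P) :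
    MemLp (gradientNoise n τ η F g θ₀ t k u) 2 P :=
  ((memLp_finsetSum Finset.univ fun i _ =>
    (hg.memLp t k hk u i).sub ((hF u).memLp_gradient_comp h)).const_smul
      (1 / (N u : ℝ))).const_smul √(3 / ((2 : ℝ) ^ (2 * n) - 1))

/-- The range includes `k = τ`, so that the end of a round supplies the start of the next at time
`(t + 1) * τ`. -/
theorem regular_clientModel_of_globalModel {t : ℕ}
    (h : StronglyMeasurable[𝓕 (t * τ)]
        (fun ω => globalModel n τ η F (fun t k u i => g t k u i ω) θ₀ t) ∧
      MemLp (fun ω => globalModel n τ η F (fun t k u i => g t k u i ω) θ₀ t) 2 P)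
    {k : ℕ} (hk : k ≤ τ) (u : Fin U) :
    StronglyMeasurable[𝓕 (t * τ + k)]
        (fun ω => clientModel n τ η F (fun t k u i => g t k u i ω) θ₀ t k u) ∧
      MemLp (fun ω => clientModel n τ η F (fun t k u i => g t k u i ω) θ₀ t k u) 2 P := by
  induction k with
  | zero => exact h
  | succ k ih =>
    obtain ⟨h1, h2⟩ := ih (by omega)
    have hstep := fun ω => (isNoisyDescent_clientModel n τ η F g θ₀ t u ω).succ k
    refine ⟨?_, ?_⟩
    · rw [funext hstep]
      refine (h1.mono (𝓕.mono (Nat.le_succ _))).sub (StronglyMeasurable.fun_const_smul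
        (StronglyMeasurable.add ?_
          (stronglyMeasurable_gradientNoise_of_clientModel hg hF (by omega) h1)) η)
      exact ((hF u).lipschitzWith_gradient.continuous.comp_stronglyMeasurable h1).mono
        (𝓕.mono (Nat.le_succ _))
    · rw [funext hstep]
      exact h2.sub ((((hF u).memLp_gradient_comp h2).add
        (memLp_gradientNoise_of_clientModel hg hF (by omega) h2)).const_smul η)

theorem regular_globalModel (t : ℕ) :
    StronglyMeasurable[𝓕 (t * τ)]
        (fun ω => globalModel n τ η F (fun t k u i => g t k u i ω) θ₀ t) ∧
      MemLp (fun ω => globalModel n τ η F (fun t k u i => g t k u i ω) θ₀ t) 2 P := by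
  induction t with
  | zero => exact ⟨stronglyMeasurable_const, memLp_const _⟩
  | succ t ih =>
    have h := regular_clientModel_of_globalModel hg hF ih le_rfl
    rw [Nat.succ_mul]
    exact ⟨StronglyMeasurable.fun_const_smul
      (Finset.stronglyMeasurable_fun_sum _ fun u _ => (h u).1) (1 / (U : ℝ)),
      (memLp_finsetSum Finset.univ fun u _ => (h u).2).const_smul (1 / (U : ℝ))⟩

theorem regular_clientModel {t k : ℕ} (hk : k ≤ τ) (u : Fin U) :
    StronglyMeasurable[𝓕 (t * τ + k)]
        (fun ω => clientModel n τ η F (fun t k u i => g t k u i ω) θ₀ t k u) ∧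
      MemLp (fun ω => clientModel n τ η F (fun t k u i => g t k u i ω) θ₀ t k u) 2 P :=
  regular_clientModel_of_globalModel hg hF (regular_globalModel hg hF t) hk u

theorem memLp_gradientNoise {t k : ℕ} (hk : k < τ) (u : Fin U) :
    MemLp (gradientNoise n τ η F g θ₀ t k u) 2 P :=
  memLp_gradientNoise_of_clientModel hg hF hk (regular_clientModel hg hF hk.le u).2

theorem condExp_gradientNoise (hN : ∀ u, 1 ≤ N u) {t k : ℕ} (hk : k < τ) (u : Fin U) :
    P[gradientNoise n τ η F g θ₀ t k u | 𝓕 (t * τ + k)] =ᵐ[P] 0 := by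
  obtain ⟨hm, hL2⟩ := regular_clientModel hg hF (t := t) hk.le u
  set G : Ω → Param d := fun ω => gradient (F u)
    (clientModel n τ η F (fun t k u i => g t k u i ω) θ₀ t k u) with hG
  have hGm : StronglyMeasurable[𝓕 (t * τ + k)] G :=
    (hF u).lipschitzWith_gradient.continuous.comp_stronglyMeasurable hm
  have hGi : Integrable G P := ((hF u).memLp_gradient_comp hL2).integrable one_le_two
  have hN0 : (N u : ℝ) ≠ 0 := by have := hN u; positivity
  have hgi : Integrable (fun ω => (1 / (N u : ℝ)) • ∑ i, g t k u i ω) P :=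
    (integrable_finsetSum _ fun i _ => (hg.memLp t k hk u i).integrable one_le_two).smul (1 / (N u : ℝ))
  have hfun : gradientNoise n τ η F g θ₀ t k u = √(3 / ((2 : ℝ) ^ (2 * n) - 1)) •
      ((fun ω => (1 / (N u : ℝ)) • ∑ i, g t k u i ω) - G) := by
    funext ω
    simp only [gradientNoise, Pi.smul_apply, Pi.sub_apply, hG, Finset.sum_sub_distrib,
      Finset.sum_const, Finset.card_univ, Fintype.card_fin, smul_sub,
      ← Nat.cast_smul_eq_nsmul ℝ, smul_smul, one_div_mul_cancel hN0, one_smul]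
  rw [hfun]
  refine (condExp_smul _ _ _).trans ?_
  filter_upwards [condExp_sub hgi hGi (𝓕 (t * τ + k)), hg.unbiased t k hk u] with ω h1 h2
  rw [Pi.smul_apply, h1, Pi.sub_apply, h2,
    condExp_of_stronglyMeasurable (𝓕.le _) hGm hGi]
  simp [hG]

/-- Jensen over the data points suffices, so their deviations may be correlated; no gain of `1 / N
u` is claimed. -/
theorem integral_norm_gradientNoise_sq_le (hn : 1 ≤ n) (hN : ∀ u, 1 ≤ N u) {t k : ℕ}
    (hk : k < τ) (u : Fin U) :
    ∫ ω, ‖gradientNoise n τ η F g θ₀ t k u ω‖ ^ 2 ∂P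
      ≤ 3 * σ ^ 2 / ((2 : ℝ) ^ (2 * n) - 1) := by
  have hpow : (0 : ℝ) < 2 ^ (2 * n) - 1 :=
    sub_pos.2 (one_lt_pow₀ one_lt_two (by omega))
  have hq : 0 ≤ 3 / ((2 : ℝ) ^ (2 * n) - 1) := by positivity
  have hN0 : (0 : ℝ) < N u := by exact_mod_cast hN u
  have hi : ∀ i, Integrable (fun ω => ‖g t k u i ω - gradient (F u)
      (clientModel n τ η F (fun t k u i => g t k u i ω) θ₀ t k u)‖ ^ 2) P := fun i =>
    ((hg.memLp t k hk u i).sub ((hF u).memLp_gradient_comp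
      (regular_clientModel hg hF hk.le u).2)).integrable_norm_pow (p := 2) two_ne_zero
  have hint : Integrable (fun ω => 3 / ((2 : ℝ) ^ (2 * n) - 1) * ((1 / (N u : ℝ)) *
      ∑ i, ‖g t k u i ω - gradient (F u)
        (clientModel n τ η F (fun t k u i => g t k u i ω) θ₀ t k u)‖ ^ 2)) P :=
    ((integrable_finsetSum _ fun i _ => hi i).const_mul _).const_mul _
  refine (integral_mono ((memLp_gradientNoise hg hF hk u).integrable_norm_pow (p := 2)
    two_ne_zero) hint fun ω => ?_).trans ?_
  · simp only [gradientNoise]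
    rw [norm_smul, mul_pow, Real.norm_eq_abs, sq_abs, Real.sq_sqrt hq]
    exact mul_le_mul_of_nonneg_left (norm_average_sq_le _) hq
  · rw [integral_const_mul, integral_const_mul, integral_finsetSum _ fun i _ => hi i]
    have h := Finset.sum_le_sum fun (i : Fin (N u)) (_ : i ∈ Finset.univ) =>
      hg.variance_le t k hk u i
    rw [Finset.sum_const, Finset.card_univ, Fintype.card_fin, nsmul_eq_mul] at h
    calc _ ≤ 3 / ((2 : ℝ) ^ (2 * n) - 1) * (1 / (N u : ℝ) * (N u * σ ^ 2)) := by gcongr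
      _ = _ := by field_simp

end Run

/-! ### Integrability of the loss and Jensen's inequality -/

section Loss

variable {d U : ℕ} {F : Fin U → Param d → ℝ} {θs : Param d} {L : ℝ}

theorem globalLoss_sub_le (hU : 1 ≤ U) (hF : ∀ u, IsLSmooth L (F u))
    (hmin : ∀ θ, globalLoss F θs ≤ globalLoss F θ) (θ : Param d) :
    globalLoss F θ - globalLoss F θs ≤ L / 2 * ‖θ - θs‖ ^ 2 := by
  have hU0 : (0 : ℝ) < U := by exact_mod_cast hU
  have h := Finset.sum_le_sum fun (u : Fin U) (_ : u ∈ Finset.univ) => (hF u).le_quadratic θs θ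
  rw [Finset.sum_add_distrib, Finset.sum_add_distrib, ← sum_inner,
    sum_gradient_eq_zero_of_isMin hU (fun u => (hF u).differentiable) hmin, inner_zero_left,
    add_zero, Finset.sum_const, Finset.card_univ, Fintype.card_fin, nsmul_eq_mul] at h
  have h' := mul_le_mul_of_nonneg_left h (by positivity : (0 : ℝ) ≤ 1 / U)
  rw [mul_add, ← mul_assoc (1 / (U : ℝ)) (U : ℝ), one_div_mul_cancel hU0.ne', one_mul] at h'
  unfold globalLoss
  linarith

/-- The gap lies between 0 and a multiple of the squared distance to `θs`, which is integrable. -/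
theorem integrable_globalLoss_comp {Ω : Type*} {mΩ : MeasurableSpace Ω} {P : Measure Ω}
    [IsFiniteMeasure P] (hU : 1 ≤ U) (hF : ∀ u, IsLSmooth L (F u))
    (hmin : ∀ θ, globalLoss F θs ≤ globalLoss F θ) {x : Ω → Param d} (hx : MemLp x 2 P) :
    Integrable (fun ω => globalLoss F (x ω)) P := by
  have hcont : Continuous (globalLoss F) :=
    continuous_const.mul (continuous_finsetSum _ fun u _ => (hF u).differentiable.continuous)
  have hsq : Integrable (fun ω => L / 2 * ‖x ω - θs‖ ^ 2) P :=
    ((hx.sub (memLp_const θs)).integrable_norm_pow (p := 2) two_ne_zero).const_mul _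
  have hsub : Integrable (fun ω => globalLoss F (x ω) - globalLoss F θs) P := by
    refine hsq.mono' ((hcont.comp_aestronglyMeasurable hx.aestronglyMeasurable).sub
      aestronglyMeasurable_const) (Filter.Eventually.of_forall fun ω => ?_)
    rw [Real.norm_of_nonneg (sub_nonneg.2 (hmin _))]
    exact globalLoss_sub_le hU hF hmin (x ω)
  refine (hsub.add (integrable_const (globalLoss F θs))).congr (Filter.Eventually.of_forall ?_)
  exact fun ω => sub_add_cancel _ _

theorem map_average_le {f : Param d → ℝ}
    (hc : ∀ x y, f x + inner ℝ (gradient f x) (y - x) ≤ f y) {T : ℕ} (hT : 1 ≤ T)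
    (x : ℕ → Param d) :
    f ((1 / (T : ℝ)) • ∑ t ∈ Finset.range T, x t)
      ≤ (1 / (T : ℝ)) * ∑ t ∈ Finset.range T, f (x t) := by
  have hT0 : (0 : ℝ) < T := by exact_mod_cast hT
  set y := (1 / (T : ℝ)) • ∑ t ∈ Finset.range T, x t with hy
  -- Tangent plane at the average: its linear terms cancel in the sum.
  have h := Finset.sum_le_sum fun t (_ : t ∈ Finset.range T) => hc y (x t)
  have h0 : ∑ t ∈ Finset.range T, (x t - y) = 0 := by
    rw [Finset.sum_sub_distrib, Finset.sum_const, Finset.card_range, ← Nat.cast_smul_eq_nsmul ℝ,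
      hy, smul_smul, mul_one_div_cancel hT0.ne', one_smul, sub_self]
  rw [Finset.sum_add_distrib, ← inner_sum, h0, inner_zero_right, add_zero, Finset.sum_const,
    Finset.card_range, nsmul_eq_mul] at h
  rw [one_div, inv_mul_eq_div, le_div_iff₀ hT0]
  linarith

theorem globalLoss_average_le
    (hc : ∀ u x y, F u x + inner ℝ (gradient (F u) x) (y - x) ≤ F u y) {T : ℕ} (hT : 1 ≤ T)
    (x : ℕ → Param d) :
    globalLoss F ((1 / (T : ℝ)) • ∑ t ∈ Finset.range T, x t)
      ≤ (1 / (T : ℝ)) * ∑ t ∈ Finset.range T, globalLoss F (x t) := by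
  simp only [globalLoss]
  rw [← Finset.mul_sum, mul_left_comm, Finset.sum_comm,
    Finset.mul_sum (a := 1 / (T : ℝ))]
  exact mul_le_mul_of_nonneg_left (Finset.sum_le_sum fun u _ => map_average_le (hc u) hT x)
    (by positivity)

end Loss

/-! ### Expected progress and telescoping over rounds -/

section Rounds

variable {d U n τ : ℕ} {N : Fin U → ℕ} {η : ℝ} {F : Fin U → Param d → ℝ} {θ₀ θs : Param d}
  {Ω : Type*} {mΩ : MeasurableSpace Ω} {P : Measure Ω} [IsProbabilityMeasure P]
  {𝓕 : Filtration ℕ mΩ} {g : ℕ → ℕ → (u : Fin U) → Fin (N u) → Ω → Param d} {σ σs L : ℝ}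

theorem integral_norm_average_gradientNoise_sq_le (hn : 1 ≤ n) (hU : 1 ≤ U) (hN : ∀ u, 1 ≤ N u)
    (hF : ∀ u, IsLSmooth L (F u)) (hg : IsStochasticGradient P 𝓕 n τ η F g θ₀ σ) {t k : ℕ}
    (hk : k < τ) :
    ∫ ω, (1 / (U : ℝ)) * ∑ u, ‖gradientNoise n τ η F g θ₀ t k u ω‖ ^ 2 ∂P
      ≤ 3 * σ ^ 2 / ((2 : ℝ) ^ (2 * n) - 1) := by
  have hU0 : (0 : ℝ) < U := by exact_mod_cast hU
  rw [integral_const_mul, integral_finsetSum _ fun u _ =>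
    (memLp_gradientNoise hg hF hk u).integrable_norm_pow (p := 2) two_ne_zero]
  have h := Finset.sum_le_sum fun (u : Fin U) (_ : u ∈ Finset.univ) =>
    integral_norm_gradientNoise_sq_le hg hF hn hN (t := t) hk u
  rw [Finset.sum_const, Finset.card_univ, Fintype.card_fin, nsmul_eq_mul] at h
  rw [one_div, inv_mul_eq_div, div_le_iff₀ hU0]
  linarith

theorem integral_norm_globalModel_succ_sub_sq_le (hn : 1 ≤ n) (hU : 1 ≤ U) (hN : ∀ u, 1 ≤ N u)
    (hL : 0 < L) (hη : 0 < η) (hτ : η * τ * L ≤ 1 / 6) (hF : ∀ u, IsLSmooth L (F u))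
    (hc : ∀ u x y, F u x + inner ℝ (gradient (F u) x) (y - x) ≤ F u y)
    (hmin : ∀ θ, globalLoss F θs ≤ globalLoss F θ)
    (hσs : (1 / (U : ℝ)) * ∑ u, ‖gradient (F u) θs‖ ^ 2 ≤ σs ^ 2)
    (hg : IsStochasticGradient P 𝓕 n τ η F g θ₀ σ) (t : ℕ) :
    ∫ ω, ‖globalModel n τ η F (fun t k u i => g t k u i ω) θ₀ (t + 1) - θs‖ ^ 2 ∂P
      ≤ ∫ ω, ‖globalModel n τ η F (fun t k u i => g t k u i ω) θ₀ t - θs‖ ^ 2 ∂P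
      - 1 / 4 * η * τ * (∫ ω, globalLoss F
          (globalModel n τ η F (fun t k u i => g t k u i ω) θ₀ t) ∂P - globalLoss F θs)
      + 15 / 2 * η ^ 3 * τ ^ 2 * L * (τ * σs ^ 2 + τ * (3 * σ ^ 2 / ((2 : ℝ) ^ (2 * n) - 1)))
      + 2 * η ^ 2 * (τ * (3 * σ ^ 2 / ((2 : ℝ) ^ (2 * n) - 1))) := by
  set V := 3 * σ ^ 2 / ((2 : ℝ) ^ (2 * n) - 1) with hV
  set X : ℕ → Ω → Param d := fun t ω => globalModel n τ η F (fun t k u i => g t k u i ω) θ₀ t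
    with hX
  set ξ := gradientNoise n τ η F g θ₀ t with hξ
  set ζ : ℕ → Ω → Param d := fun k ω => (1 / (U : ℝ)) • ∑ u, ξ k u ω with hζ
  have hXr : ∀ t, StronglyMeasurable[𝓕 (t * τ)] (X t) ∧ MemLp (X t) 2 P :=
    fun t => regular_globalModel hg hF t
  have hξL : ∀ k < τ, ∀ u, MemLp (ξ k u) 2 P := fun k hk u => memLp_gradientNoise hg hF hk u
  have hζL : ∀ k < τ, MemLp (ζ k) 2 P := fun k hk =>
    (memLp_finsetSum Finset.univ fun u _ => hξL k hk u).const_smul (1 / (U : ℝ))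
  have hζm : ∀ k < τ, StronglyMeasurable[𝓕 (t * τ + k + 1)] (ζ k) := fun k hk =>
    StronglyMeasurable.fun_const_smul (Finset.stronglyMeasurable_fun_sum _ fun u _ =>
      stronglyMeasurable_gradientNoise_of_clientModel hg hF hk
        (regular_clientModel hg hF hk.le u).1) (1 / (U : ℝ))
  have hζ0 : ∀ k < τ, P[ζ k | 𝓕 (t * τ + k)] =ᵐ[P] 0 := by
    intro k hk
    have h1 : ζ k = (1 / (U : ℝ)) • ∑ u, ξ k u := by
      funext ω
      simp [hζ]
    rw [h1]
    refine (condExp_smul _ _ _).trans ?_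
    have h2 := condExp_finsetSum (m := 𝓕 (t * τ + k)) (s := Finset.univ) (f := ξ k)
      fun u _ => (hξL k hk u).integrable one_le_two
    have h3 : ∀ᵐ ω ∂P, ∀ u, (P[ξ k u | 𝓕 (t * τ + k)]) ω = 0 :=
      ae_all_iff.2 fun u => condExp_gradientNoise hg hF hN hk u
    filter_upwards [h2, h3] with ω h2 h3
    rw [Pi.smul_apply, h2, Finset.sum_apply, Finset.sum_eq_zero fun u _ => h3 u, smul_zero,
      Pi.zero_apply]
  have hXs : MemLp (fun ω => X t ω - θs) 2 P := (hXr t).2.sub (memLp_const θs)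
  have hΞL : MemLp (fun ω => ∑ k ∈ Finset.range τ, ζ k ω) 2 P :=
    memLp_finsetSum _ fun k hk => hζL k (Finset.mem_range.1 hk)
  have hcross : ∫ ω, inner ℝ (X t ω - θs) (∑ k ∈ Finset.range τ, ζ k ω) ∂P = 0 :=
    integral_inner_sum_eq_zero hζL hζ0 ((hXr t).1.sub stronglyMeasurable_const) hXs
  have hq : ∀ k < τ, Integrable (fun ω => (1 / (U : ℝ)) * ∑ u, ‖ξ k u ω‖ ^ 2) P := fun k hk =>
    (integrable_finsetSum _ fun u _ =>
      (hξL k hk u).integrable_norm_pow (p := 2) two_ne_zero).const_mul _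
  have hqV : ∀ k < τ, ∫ ω, (1 / (U : ℝ)) * ∑ u, ‖ξ k u ω‖ ^ 2 ∂P ≤ V := fun k hk =>
    integral_norm_average_gradientNoise_sq_le hn hU hN hF hg hk
  have hΞV : ∫ ω, ‖∑ k ∈ Finset.range τ, ζ k ω‖ ^ 2 ∂P ≤ τ * V := by
    rw [integral_norm_sum_sq_eq hζm hζL hζ0]
    refine (Finset.sum_le_card_nsmul _ _ V fun k hk => ?_).trans (by simp)
    have hk := Finset.mem_range.1 hk
    -- Across clients only Jensen is used, so noises of different clients may be correlated.
    exact (integral_mono ((hζL k hk).integrable_norm_pow (p := 2) two_ne_zero) (hq k hk)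
      fun ω => norm_average_sq_le fun u => ξ k u ω).trans (hqV k hk)
  have hQeq : ∀ ω, (1 / (U : ℝ)) * ∑ u, ∑ k ∈ Finset.range τ, ‖ξ k u ω‖ ^ 2
      = ∑ k ∈ Finset.range τ, (1 / (U : ℝ)) * ∑ u, ‖ξ k u ω‖ ^ 2 := fun ω => by
    rw [Finset.sum_comm, Finset.mul_sum]
  have hQi : Integrable
      (fun ω => (1 / (U : ℝ)) * ∑ u, ∑ k ∈ Finset.range τ, ‖ξ k u ω‖ ^ 2) P := by
    simp_rw [hQeq]
    exact integrable_finsetSum _ fun k hk => hq k (Finset.mem_range.1 hk)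
  have hQV : ∫ ω, (1 / (U : ℝ)) * ∑ u, ∑ k ∈ Finset.range τ, ‖ξ k u ω‖ ^ 2 ∂P ≤ τ * V := by
    simp_rw [hQeq]
    rw [integral_finsetSum _ fun k hk => hq k (Finset.mem_range.1 hk)]
    exact (Finset.sum_le_card_nsmul _ _ V fun k hk => hqV k (Finset.mem_range.1 hk)).trans
      (by simp)
  have hpt : ∀ ω, ‖X (t + 1) ω - θs‖ ^ 2 ≤ ‖X t ω - θs‖ ^ 2
      - 1 / 4 * η * τ * (globalLoss F (X t ω) - globalLoss F θs)
      + 15 / 2 * η ^ 3 * τ ^ 2 * L * (τ * σs ^ 2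
        + (1 / (U : ℝ)) * ∑ u, ∑ k ∈ Finset.range τ, ‖ξ k u ω‖ ^ 2)
      + 2 * η ^ 2 * ‖∑ k ∈ Finset.range τ, ζ k ω‖ ^ 2
      - 2 * η * inner ℝ (X t ω - θs) (∑ k ∈ Finset.range τ, ζ k ω) := fun ω =>
    norm_average_noisyDescent_sub_sq_le hU hL hη hτ hF hc hmin hσs
      fun u => isNoisyDescent_clientModel n τ η F g θ₀ t u ω
  have i0 : ∀ t, Integrable (fun ω => ‖X t ω - θs‖ ^ 2) P := fun t =>
    ((hXr t).2.sub (memLp_const θs)).integrable_norm_pow (p := 2) two_ne_zero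
  have i1 : Integrable
      (fun ω => 1 / 4 * η * τ * (globalLoss F (X t ω) - globalLoss F θs)) P :=
    ((integrable_globalLoss_comp hU hF hmin (hXr t).2).sub (integrable_const _)).const_mul _
  have i2 : Integrable (fun ω => 15 / 2 * η ^ 3 * τ ^ 2 * L * (τ * σs ^ 2
      + (1 / (U : ℝ)) * ∑ u, ∑ k ∈ Finset.range τ, ‖ξ k u ω‖ ^ 2)) P :=
    ((integrable_const _).add hQi).const_mul _
  have i3 : Integrable (fun ω => 2 * η ^ 2 * ‖∑ k ∈ Finset.range τ, ζ k ω‖ ^ 2) P :=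
    (hΞL.integrable_norm_pow (p := 2) two_ne_zero).const_mul _
  have i4 : Integrable
      (fun ω => 2 * η * inner ℝ (X t ω - θs) (∑ k ∈ Finset.range τ, ζ k ω)) P :=
    (integrable_inner_of_memLp_two hXs hΞL).const_mul _
  have hint := integral_mono (i0 (t + 1)) ((((i0 t).sub i1).add i2 |>.add i3).sub i4) hpt
  rw [integral_sub' (((i0 t).sub i1).add i2 |>.add i3) i4,
    integral_add' (((i0 t).sub i1).add i2) i3, integral_add' ((i0 t).sub i1) i2,
    integral_sub' (i0 t) i1, integral_const_mul, integral_const_mul, integral_const_mul,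
    integral_const_mul, hcross, integral_sub (integrable_globalLoss_comp hU hF hmin (hXr t).2)
    (integrable_const _), integral_add (integrable_const _) hQi] at hint
  simp only [integral_const, probReal_univ, one_smul, mul_zero, sub_zero] at hint
  have e1 := mul_le_mul_of_nonneg_left hQV
    (by positivity : 0 ≤ 15 / 2 * η ^ 3 * (τ : ℝ) ^ 2 * L)
  have e2 := mul_le_mul_of_nonneg_left hΞV (by positivity : 0 ≤ 2 * η ^ 2)
  linarith

theorem sum_integral_globalLoss_sub_le (hn : 1 ≤ n) (hU : 1 ≤ U) (hN : ∀ u, 1 ≤ N u)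
    (hL : 0 < L) (hη : 0 < η) (hτ : η * τ * L ≤ 1 / 6) (hF : ∀ u, IsLSmooth L (F u))
    (hc : ∀ u x y, F u x + inner ℝ (gradient (F u) x) (y - x) ≤ F u y)
    (hmin : ∀ θ, globalLoss F θs ≤ globalLoss F θ)
    (hσs : (1 / (U : ℝ)) * ∑ u, ‖gradient (F u) θs‖ ^ 2 ≤ σs ^ 2)
    (hg : IsStochasticGradient P 𝓕 n τ η F g θ₀ σ) (T : ℕ) :
    1 / 4 * η * τ * ∑ t ∈ Finset.range T, (∫ ω, globalLoss F
        (globalModel n τ η F (fun t k u i => g t k u i ω) θ₀ t) ∂P - globalLoss F θs)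
      ≤ ‖θ₀ - θs‖ ^ 2 + T * (15 / 2 * η ^ 3 * τ ^ 2 * L
          * (τ * σs ^ 2 + τ * (3 * σ ^ 2 / ((2 : ℝ) ^ (2 * n) - 1)))
        + 2 * η ^ 2 * (τ * (3 * σ ^ 2 / ((2 : ℝ) ^ (2 * n) - 1)))) := by
  -- Keeping the final distance on the left makes the induction telescope.
  suffices h : 1 / 4 * η * τ * ∑ t ∈ Finset.range T, (∫ ω, globalLoss F
        (globalModel n τ η F (fun t k u i => g t k u i ω) θ₀ t) ∂P - globalLoss F θs)
      + ∫ ω, ‖globalModel n τ η F (fun t k u i => g t k u i ω) θ₀ T - θs‖ ^ 2 ∂P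
      ≤ ‖θ₀ - θs‖ ^ 2 + T * (15 / 2 * η ^ 3 * τ ^ 2 * L
          * (τ * σs ^ 2 + τ * (3 * σ ^ 2 / ((2 : ℝ) ^ (2 * n) - 1)))
        + 2 * η ^ 2 * (τ * (3 * σ ^ 2 / ((2 : ℝ) ^ (2 * n) - 1)))) from
    le_trans (le_add_of_nonneg_right (integral_nonneg fun ω => by positivity)) h
  induction T with
  | zero => simp [globalModel]
  | succ T ih =>
    have h := integral_norm_globalModel_succ_sub_sq_le hn hU hN hL hη hτ hF hc hmin hσs hg T
    rw [Finset.sum_range_succ, mul_add]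
    push_cast
    linarith

theorem integrable_globalLoss_averagedModel (hU : 1 ≤ U) (hF : ∀ u, IsLSmooth L (F u))
    (hmin : ∀ θ, globalLoss F θs ≤ globalLoss F θ)
    (hg : IsStochasticGradient P 𝓕 n τ η F g θ₀ σ) (T : ℕ) :
    Integrable (fun ω => globalLoss F
      (averagedModel n τ η F (fun t k u i => g t k u i ω) θ₀ T)) P :=
  integrable_globalLoss_comp hU hF hmin
    ((memLp_finsetSum (Finset.range T) fun t _ =>
      (regular_globalModel hg hF t).2).const_smul (1 / (T : ℝ)))

theorem integral_globalLoss_averagedModel_sub_le (hU : 1 ≤ U) {T : ℕ} (hT : 1 ≤ T)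
    (hF : ∀ u, IsLSmooth L (F u))
    (hc : ∀ u x y, F u x + inner ℝ (gradient (F u) x) (y - x) ≤ F u y)
    (hmin : ∀ θ, globalLoss F θs ≤ globalLoss F θ)
    (hg : IsStochasticGradient P 𝓕 n τ η F g θ₀ σ) :
    ∫ ω, globalLoss F (averagedModel n τ η F (fun t k u i => g t k u i ω) θ₀ T) ∂P
        - globalLoss F θs
      ≤ (1 / (T : ℝ)) * ∑ t ∈ Finset.range T, (∫ ω, globalLoss F
        (globalModel n τ η F (fun t k u i => g t k u i ω) θ₀ t) ∂P - globalLoss F θs) := by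
  have hT0 : (0 : ℝ) < T := by exact_mod_cast hT
  have hi : ∀ t, Integrable (fun ω => globalLoss F
      (globalModel n τ η F (fun t k u i => g t k u i ω) θ₀ t)) P := fun t =>
    integrable_globalLoss_comp hU hF hmin (regular_globalModel hg hF t).2
  have h := integral_mono (integrable_globalLoss_averagedModel hU hF hmin hg T)
    ((integrable_finsetSum (Finset.range T) fun t _ => hi t).const_mul (1 / (T : ℝ)))
    fun ω => globalLoss_average_le hc hT
      fun t => globalModel n τ η F (fun t k u i => g t k u i ω) θ₀ t
  rw [integral_const_mul, integral_finsetSum _ fun t _ => hi t] at h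
  rw [Finset.sum_sub_distrib, Finset.sum_const, Finset.card_range, nsmul_eq_mul, mul_sub,
    ← mul_assoc _ (T : ℝ), one_div_mul_cancel hT0.ne', one_mul]
  exact sub_le_sub_right h _

end Rounds

end ADPQFL

/-! ### Choice of the constant and the final bound -/

theorem mainTheorem2 :
    ∃ C : ℝ, 0 < C ∧
      ∀ (d U n τ T : ℕ) (N : Fin U → ℕ), 1 ≤ U → 1 ≤ n → 1 ≤ τ → 1 ≤ T → (∀ u, 1 ≤ N u) →
      ∀ (Ω : Type*) (mΩ : MeasurableSpace Ω) (P : Measure Ω) (_ : IsProbabilityMeasure P)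
        (𝓕 : Filtration ℕ mΩ)
        (F : Fin U → ADPQFL.Param d → ℝ)
        (g : ℕ → ℕ → (u : Fin U) → Fin (N u) → Ω → ADPQFL.Param d)
        (θ₀ θs : ADPQFL.Param d) (L m η σ σs : ℝ),
      0 < L → 0 < m →
      (∀ u, ADPQFL.IsLSmooth L (F u)) →
      (∀ u, ADPQFL.IsMStronglyConvex m (F u)) →
      (∀ θ, ADPQFL.globalLoss F θs ≤ ADPQFL.globalLoss F θ) →
      (1 / (U : ℝ)) * ∑ u, ‖gradient (F u) θs‖ ^ 2 ≤ σs ^ 2 →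
      1 / (2 * √6 * (τ : ℝ) ^ 2 * L) < η → η < 1 / (6 * (τ : ℝ) * L) →
      ADPQFL.IsStochasticGradient P 𝓕 n τ η F g θ₀ σ →
      Integrable (fun ω => ADPQFL.globalLoss F
          (ADPQFL.averagedModel n τ η F (fun t k u i => g t k u i ω) θ₀ T)) P ∧
      (∫ ω, ADPQFL.globalLoss F
          (ADPQFL.averagedModel n τ η F (fun t k u i => g t k u i ω) θ₀ T) ∂P)
          - ADPQFL.globalLoss F θs
        ≤ C * (‖θ₀ - θs‖ ^ 2 / ∑ _t ∈ Finset.range T, η * (τ : ℝ))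
          + C * (η ^ 2 * (τ : ℝ) * ((τ : ℝ) - 1) * L * σs ^ 2)
          + C * (η * (τ : ℝ) * σs ^ 2)
          + C * L * ((2 * (τ : ℝ) ^ 2 + 3 * (τ : ℝ) + 1) * η ^ 2
              * (3 * σ ^ 2 / ((2 : ℝ) ^ (2 * n) - 1))) := by
  -- The binding term is the variance: `30 + 8 · 5 = 70` copies of `Lτ²η²V` must fit into `2C`.
  refine ⟨40, by norm_num, ?_⟩
  intro d U n τ T N hU hn hτ1 hT hN Ω mΩ P _ 𝓕 F g θ₀ θs L m η σ σs hL hm hF hconv hmin hσs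
    hη1 hη2 hg
  have hc : ∀ u x y, F u x + inner ℝ (gradient (F u) x) (y - x) ≤ F u y := fun u =>
    (hconv u).add_inner_gradient_le hm.le
  have hT0 : (0 : ℝ) < T := by exact_mod_cast hT
  have hτ0 : (1 : ℝ) ≤ τ := by exact_mod_cast hτ1
  have hη : 0 < η := lt_trans (by positivity) hη1
  have hτ : η * τ * L ≤ 1 / 6 := by
    rw [lt_div_iff₀ (by positivity)] at hη2
    linarith
  -- Since `2√6 ≤ 5`, the lower bound on the step size gives this; it later converts `8ηV` into `40
  -- Lτ²η²V`.
  have hlow : 1 ≤ 5 * (τ ^ 2 * L * η) := by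
    rw [div_lt_iff₀ (by positivity)] at hη1
    have h6 : √6 ≤ 5 / 2 := Real.sqrt_le_iff.2 (by norm_num)
    have := mul_le_mul_of_nonneg_right h6 (by positivity : 0 ≤ (τ : ℝ) ^ 2 * L * η)
    linarith
  refine ⟨ADPQFL.integrable_globalLoss_averagedModel hU hF hmin hg T, ?_⟩
  have hpow : (0 : ℝ) < 2 ^ (2 * n) - 1 := sub_pos.2 (one_lt_pow₀ one_lt_two (by omega))
  have hV : 0 ≤ 3 * σ ^ 2 / ((2 : ℝ) ^ (2 * n) - 1) := by positivity
  have h1 := ADPQFL.integral_globalLoss_averagedModel_sub_le hU hT hF hc hmin hg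
  have h2 := ADPQFL.sum_integral_globalLoss_sub_le hn hU hN hL hη hτ hF hc hmin hσs hg T
  set V := 3 * σ ^ 2 / ((2 : ℝ) ^ (2 * n) - 1)
  set S := ∑ t ∈ Finset.range T, (∫ ω, ADPQFL.globalLoss F
    (ADPQFL.globalModel n τ η F (fun t k u i => g t k u i ω) θ₀ t) ∂P - ADPQFL.globalLoss F θs)
  rw [Finset.sum_const, Finset.card_range, nsmul_eq_mul]
  have h3 : 1 / (T : ℝ) * S ≤ 4 * (‖θ₀ - θs‖ ^ 2 / (T * (η * τ)))
      + 30 * (η ^ 2 * τ ^ 2 * L * (σs ^ 2 + V)) + 8 * (η * V) := by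
    have h4 := mul_le_mul_of_nonneg_left h2 (by positivity : 0 ≤ 4 / (T * (η * τ)))
    refine (le_of_eq ?_).trans (h4.trans (le_of_eq ?_))
    · field_simp
    · field_simp
      ring
  -- The whole term `30 η²τ²Lσs²`, drift included, fits into `5 ητσs²`.
  have e1 : η * τ * L * (η * τ * σs ^ 2) ≤ 1 / 6 * (η * τ * σs ^ 2) :=
    mul_le_mul_of_nonneg_right hτ (by positivity)
  have e2 := mul_le_mul_of_nonneg_right hlow (by positivity : 0 ≤ η * V)
  have e3 : 0 ≤ ‖θ₀ - θs‖ ^ 2 / (T * (η * τ)) := by positivity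
  have e4 : 0 ≤ η ^ 2 * (τ : ℝ) * (τ - 1) * L * σs ^ 2 := by
    have := sub_nonneg.2 hτ0
    positivity
  have e5 : 0 ≤ L * ((3 * τ + 1) * η ^ 2 * V) := by positivity
  have e6 : 0 ≤ L * (τ ^ 2 * η ^ 2 * V) := by positivity
  have e7 : 0 ≤ η * τ * σs ^ 2 := by positivity
  linarith
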